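/- Let $(\Omega,\mathcal F,P)$ be an atomless probability space, and let $\varphi$ be a random variable with $\varphi>0$ $P$-a.s. and $E[\varphi]=1$. Let $0\le v\le K$ be real numbers, and let $\rho:L^\infty(\Omega,\mathcal F,P)\to\mathbb R$ satisfy, for all $X,Y\in L^\infty$: - (monotonicity) if $X\le Y$ $P$-a.s., then $\rho(-X)\le\rho(-Y)$; - (convexity) $\rho(\lambda X+(1-\lambda)Y)\le\lambda\rho(X)+(1-\lambda)\rho(Y)$ for $0\le\lambda\le1$; - (law invariance) if $X$ and $Y$ have the same law under $P$, then $\rho(X)=\rho(Y)$; - $m\mapsto\rho(-m)$ is continuous and strictly increasing on $[0,K]$; - (continuity from above) if $X_n\in L^\infty$ and $X_n\searrow X$ $P$-a.s., then $\rho(X_n)\nearrow\rho(X)$. (Given monotonicity, this is equivalent to the Fatou property.) A solution of the Neyman–Pearson problem is a random variable $X^*\in L^\infty$ that minimizes $\rho(-X)$ among all $X\in L^\infty$ with $0\le X\le K$ $P$-a.s. and $E[\varphi X]\ge v$. "Increasing" means nondecreasing. Then: 1. Every $\sigma(\varphi)$-measurable solution $X^*$ is of the form $X^*=f^*(\varphi)$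 $P$-a.s. for some deterministic increasing function $f^*:\mathbb R\to[0,K]$. 2. If $X^*$ is any solution, not necessarily $\sigma(\varphi)$-measurable, then there exists a deterministic increasing function $f:\mathbb R\to[0,K]$ such that $f(\varphi)$ is also a solution. -/

import Mathlib

open MeasureTheory Filter Topology
open scoped ENNReal

namespace NeymanPearson

/-- A measure is atomless if every measurable set of positive measure has a measurable
subset of strictly smaller, but still positive, measure. (Mathlib's `NoAtoms` only says that
singletons are null, which is a weaker notion on a general measurable space.) -/
def Atomless {Ω : Type*} [MeasurableSpace Ω] (P : Measure Ω) : Prop :=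
  ∀ A : Set Ω, MeasurableSet A → 0 < P A →
    ∃ B : Set Ω, MeasurableSet B ∧ B ⊆ A ∧ 0 < P B ∧ P B < P A

/-- The standing axioms on a real-valued functional `ρ` on `L^∞(Ω, 𝓕, P)`. -/
structure IsAdmissible {Ω : Type*} [MeasurableSpace Ω] (P : Measure Ω) [IsProbabilityMeasure P]
    (K : ℝ) (ρ : Lp ℝ ∞ P → ℝ) : Prop where
  /-- Monotonicity; `≤` on `Lp` is the almost sure order. -/
  monotone : ∀ X Y : Lp ℝ ∞ P, X ≤ Y → ρ (-X) ≤ ρ (-Y)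
  /-- Convexity. -/
  convex : ∀ (X Y : Lp ℝ ∞ P) (l : ℝ), 0 ≤ l → l ≤ 1 →
    ρ (l • X + (1 - l) • Y) ≤ l * ρ X + (1 - l) * ρ Y
  /-- Law invariance. -/
  lawInvariant : ∀ X Y : Lp ℝ ∞ P, P.map X = P.map Y → ρ X = ρ Y
  /-- Continuity along constants in `[0, K]`. -/
  continuousOn_const : ContinuousOn (fun m : ℝ => ρ (-(Lp.const ∞ P m))) (Set.Icc 0 K)
  /-- Strict monotonicity along constants in `[0, K]`. -/
  strictMonoOn_const : StrictMonoOn (fun m : ℝ => ρ (-(Lp.const ∞ P m))) (Set.Icc 0 K)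
  /-- Continuity from above: if `X n` decreases to `Y` almost surely, then `ρ (X n)` converges
  to `ρ Y` (from below, by monotonicity). -/
  continuousFromAbove : ∀ (X : ℕ → Lp ℝ ∞ P) (Y : Lp ℝ ∞ P), Antitone X →
    (∀ᵐ ω ∂P, Tendsto (fun n => X n ω) atTop (𝓝 (Y ω))) →
    Tendsto (fun n => ρ (X n)) atTop (𝓝 (ρ Y))

/-- The constraints `0 ≤ X ≤ K` almost surely and `E[φ X] ≥ v`. -/
def IsFeasible {Ω : Type*} [MeasurableSpace Ω] (P : Measure Ω) (φ : Ω → ℝ) (K v : ℝ)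
    (X : Lp ℝ ∞ P) : Prop :=
  (∀ᵐ ω ∂P, 0 ≤ X ω ∧ X ω ≤ K) ∧ v ≤ ∫ ω, φ ω * X ω ∂P

/-- `X` solves the Neyman-Pearson problem: it minimizes `ρ (-X)` under the constraints. -/
def IsSolution {Ω : Type*} [MeasurableSpace Ω] (P : Measure Ω) (φ : Ω → ℝ) (K v : ℝ)
    (ρ : Lp ℝ ∞ P → ℝ) (X : Lp ℝ ∞ P) : Prop :=
  IsFeasible P φ K v X ∧ ∀ Y : Lp ℝ ∞ P, IsFeasible P φ K v Y → ρ (-X) ≤ ρ (-Y)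

/-- The class `X` is `σ(φ)`-measurable: it has a `σ(φ)`-measurable representative. -/
def IsSigmaMeasurable {Ω : Type*} [MeasurableSpace Ω] (P : Measure Ω) (φ : Ω → ℝ)
    (X : Lp ℝ ∞ P) : Prop :=
  ∃ Z : Ω → ℝ, Measurable[MeasurableSpace.comap φ inferInstance] Z ∧ X =ᵐ[P] Z

end NeymanPearson

namespace NeymanPearson

/-! Every payoff `X` with values in `[0, K]` is improved by some `f(φ)`, `f` increasing. A uniform
`V` on each atom of `φ` turns `φ` into a uniform variable, and the quantile function of `X`
evaluated there gives a rearrangement `R`: it has the law of `X`, hence its risk, and is comonotone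
with `φ`, so `E[φR] ≥ E[φX]` by Hardy-Littlewood.

On atoms of `φ`, `R` still depends on `V`. Rotating `V` changes neither the law of `R` nor `E[φR]`,
and averages over `n` equally spaced rotations are uniformly within `K / n` of some `f(φ)`.
Convexity bounds the risk of the averages and continuity from above carries the bound to `f(φ)`.
This is `exists_monotone_improvement`, and it gives the second claim.

For the first, the moment constraint binds at every solution (`IsSolution.integral_eq`): otherwise
scaling down would lower the risk. So `X` and its improvement have the same moment, and equality in
Hardy-Littlewood makes `X` comonotone with `φ`; being a function of `φ`, `X` is an increasing one.
-/

/-! ### Atomless measures and diffuse random variables -/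

lemma Atomless.exists_subset_measure_le {Ω : Type*} [MeasurableSpace Ω] {P : Measure Ω}
    [IsFiniteMeasure P] (hP : Atomless P) {A : Set Ω} (hA : MeasurableSet A) (hA0 : 0 < P A)
    {ε : ℝ≥0∞} (hε : ε ≠ 0) :
    ∃ B, MeasurableSet B ∧ B ⊆ A ∧ 0 < P B ∧ P B ≤ ε := by
  have key : ∀ n : ℕ, ∃ B, MeasurableSet B ∧ B ⊆ A ∧ 0 < P B ∧ P B ≤ P A * (2⁻¹) ^ n := by
    intro n
    induction n with
    | zero => exact ⟨A, hA, subset_rfl, hA0, by simp⟩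
    | succ n ih =>
      obtain ⟨B, hB, hBA, hB0, hBle⟩ := ih
      obtain ⟨C, hC, hCB, hC0, hClt⟩ := hP B hB hB0
      have hadd : P C + P (B \ C) = P B := by
        rw [measure_sdiff hCB hC.nullMeasurableSet (measure_ne_top _ _)]
        exact add_tsub_cancel_of_le hClt.le
      have hpos : 0 < P (B \ C) := by
        rw [measure_sdiff hCB hC.nullMeasurableSet (measure_ne_top _ _)]
        exact tsub_pos_of_lt hClt
      have hhalf : P B * 2⁻¹ ≤ P A * 2⁻¹ ^ (n + 1) := by
        rw [pow_succ, ← mul_assoc]; gcongr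
      rcases le_or_gt (P C) (P B * 2⁻¹) with h | h
      · exact ⟨C, hC, hCB.trans hBA, hC0, h.trans hhalf⟩
      · refine ⟨B \ C, hB.diff hC, Set.sdiff_subset.trans hBA, hpos, le_trans ?_ hhalf⟩
        by_contra! h'
        have := ENNReal.add_lt_add h h'
        rw [hadd, ← mul_add, ENNReal.inv_two_add_inv_two, mul_one] at this
        exact lt_irrefl _ this
  have hlim : Tendsto (fun n : ℕ => P A * (2⁻¹ : ℝ≥0∞) ^ n) atTop (𝓝 (P A * 0)) :=
    ENNReal.Tendsto.const_mul (ENNReal.tendsto_pow_atTop_nhds_zero_of_lt_one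
      (by simp)) (Or.inr (measure_ne_top _ _))
  rw [mul_zero] at hlim
  obtain ⟨n, hn⟩ := (hlim.eventually_lt_const (pos_iff_ne_zero.2 hε)).exists
  obtain ⟨B, h1, h2, h3, h4⟩ := key n
  exact ⟨B, h1, h2, h3, h4.trans hn.le⟩

/-- A maximal disjoint family of small sets of positive measure is countable, and a non-null
remainder would contain one more such set. -/
lemma Atomless.exists_countable_partition {Ω : Type*} [MeasurableSpace Ω] {P : Measure Ω}
    [IsFiniteMeasure P] (hP : Atomless P) {ε : ℝ≥0∞} (hε : ε ≠ 0) :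
    ∃ C : Set (Set Ω), C.Countable ∧ (∀ B ∈ C, MeasurableSet B ∧ P B ≤ ε) ∧ P (⋃₀ C)ᶜ = 0 := by
  let S : Set (Set (Set Ω)) :=
    {C | C.PairwiseDisjoint id ∧ ∀ B ∈ C, MeasurableSet B ∧ 0 < P B ∧ P B ≤ ε}
  obtain ⟨C, hC⟩ : ∃ C, Maximal (· ∈ S) C := by
    refine zorn_subset S fun c hcS hc => ⟨⋃₀ c, ⟨?_, ?_⟩, fun s hs => Set.subset_sUnion_of_mem hs⟩
    · exact (Set.pairwiseDisjoint_sUnion hc.directedOn).2 fun s hs => (hcS hs).1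
    · rintro B ⟨s, hs, hB⟩
      exact (hcS hs).2 B hB
  have hcount : C.Countable := by
    have h := Measure.countable_meas_pos_of_disjoint_iUnion (μ := P) (As := fun B : C => (B : Set Ω))
      (fun B => (hC.prop.2 B B.2).1) (fun B B' h => hC.prop.1 B.2 B'.2 (by simpa [Subtype.ext_iff] using h))
    have h' : {i : C | 0 < P (i : Set Ω)} = Set.univ :=
      Set.eq_univ_of_forall fun B => (hC.prop.2 B B.2).2.1
    rw [h'] at h
    exact Set.countable_coe_iff.1 (Set.countable_univ_iff.1 h)
  have hmeas : MeasurableSet (⋃₀ C) :=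
    MeasurableSet.sUnion hcount fun B hB => (hC.prop.2 B hB).1
  refine ⟨C, hcount, fun B hB => ⟨(hC.prop.2 B hB).1, (hC.prop.2 B hB).2.2⟩, ?_⟩
  by_contra h0
  obtain ⟨B, hB, hBsub, hB0, hBε⟩ :=
    hP.exists_subset_measure_le hmeas.compl (pos_iff_ne_zero.2 h0) hε
  have hdisj : ∀ B' ∈ C, Disjoint B B' := fun B' hB' =>
    Set.disjoint_left.2 fun ω h1 h2 => hBsub h1 ⟨B', hB', h2⟩
  have hin : insert B C ∈ S := by
    refine ⟨hC.prop.1.insert fun B' hB' _ => hdisj B' hB', ?_⟩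
    rintro B' (rfl | hB')
    · exact ⟨hB, hB0, hBε⟩
    · exact hC.prop.2 B' hB'
  have hBC : B ∈ C := hC.le_of_ge hin (Set.subset_insert _ _) (Set.mem_insert _ _)
  have := hdisj B hBC
  rw [disjoint_self] at this
  simp [this] at hB0

/-- An atomless finite measure carries a real random variable whose law has no atoms. -/
lemma Atomless.exists_measurable_null_fibers {Ω : Type*} [MeasurableSpace Ω] {P : Measure Ω}
    [IsFiniteMeasure P] (hP : Atomless P) :
    ∃ w : Ω → ℝ, Measurable w ∧ ∀ x, P (w ⁻¹' {x}) = 0 := by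
  classical
  have hε : ∀ n : ℕ, ((n : ℝ≥0∞) + 1)⁻¹ ≠ 0 := fun n => by simp
  choose C hCc hCm hC0 using fun n => hP.exists_countable_partition (hε n)
  -- The empty set only guarantees that the family is nonempty, hence enumerable by `ℕ`.
  have hcount : (insert ∅ (⋃ n, C n)).Countable := (Set.countable_iUnion hCc).insert _
  obtain ⟨B, hB⟩ := hcount.exists_eq_range (Set.insert_nonempty _ _)
  have hBm : ∀ n, MeasurableSet (B n) := fun n => by
    have : B n ∈ insert ∅ (⋃ n, C n) := hB ▸ Set.mem_range_self n
    rcases this with h | h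
    · simp [h]
    · obtain ⟨m, hm⟩ := Set.mem_iUnion.1 h
      exact (hCm m _ hm).1
  -- Points with the same code lie in the same cells, so a fibre lies in one cell of the `n`-th
  -- partition or in its null remainder.
  let g : Ω → ℕ → Bool := fun ω n => decide (ω ∈ B n)
  have hg : Measurable g := measurable_pi_iff.2 fun n =>
    measurable_to_bool (by
      have : (fun ω => g ω n) ⁻¹' {true} = B n := by ext; simp [g]
      rw [this]; exact hBm n)
  refine ⟨fun ω => embeddingReal (ℕ → Bool) (g ω), (measurable_embeddingReal _).comp hg, fun x => ?_⟩
  set F := (fun ω => embeddingReal (ℕ → Bool) (g ω)) ⁻¹' {x} with hF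
  have hsame : ∀ ω ∈ F, ∀ ω' ∈ F, ∀ n, ∀ A ∈ C n, ω ∈ A → ω' ∈ A := by
    intro ω hω ω' hω' n A hA hωA
    have hAr : A ∈ Set.range B := hB ▸ Set.mem_insert_of_mem _ (Set.mem_iUnion.2 ⟨n, hA⟩)
    obtain ⟨k, rfl⟩ := hAr
    have : g ω = g ω' :=
      (measurableEmbedding_embeddingReal (ℕ → Bool)).injective
        ((show _ = x from hω).trans (show _ = x from hω').symm)
    have := congrFun this k
    simp only [g, decide_eq_decide] at this
    exact this.1 hωA
  have hle : ∀ n : ℕ, P F ≤ ((n : ℝ≥0∞) + 1)⁻¹ := by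
    intro n
    by_cases h : ∃ ω ∈ F, ω ∈ ⋃₀ C n
    · obtain ⟨ω, hω, A, hA, hωA⟩ := h
      exact (measure_mono fun ω' hω' => hsame ω hω ω' hω' n A hA hωA).trans (hCm n A hA).2
    · push Not at h
      exact (measure_mono_null (fun ω hω => h ω hω) (hC0 n)).le.trans zero_le
  refine le_antisymm (ge_of_tendsto' (x := atTop) (f := fun n : ℕ => ((n : ℝ≥0∞) + 1)⁻¹) ?_ hle) zero_le
  have := (ENNReal.tendsto_inv_nat_nhds_zero).comp (tendsto_add_atTop_nat 1)
  simpa [Function.comp_def] using this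

/-! ### Uniform variables from distribution functions -/

/-- The uniform distribution is characterised by a two-sided bound on its distribution function. -/
lemma map_eq_uniform {Ω : Type*} [MeasurableSpace Ω] {P : Measure Ω} [IsProbabilityMeasure P]
    {U : Ω → ℝ} (hU : Measurable U)
    (hlt : ∀ t ∈ Set.Ioo (0 : ℝ) 1, P {ω | U ω < t} ≤ ENNReal.ofReal t)
    (hle : ∀ t ∈ Set.Ioo (0 : ℝ) 1, ENNReal.ofReal t ≤ P {ω | U ω ≤ t}) :
    P.map U = volume.restrict (Set.Ioc 0 1) := by
  have := Measure.isProbabilityMeasure_map (μ := P) hU.aemeasurable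
  have hup : ∀ t : ℝ, t < 1 → P {ω | U ω ≤ t} ≤ ENNReal.ofReal t := by
    intro t ht
    have hlim : Tendsto (fun s : ℝ => ENNReal.ofReal s) (𝓝[>] (max t 0))
        (𝓝 (ENNReal.ofReal (max t 0))) :=
      (ENNReal.continuous_ofReal.tendsto _).mono_left nhdsWithin_le_nhds
    have : P {ω | U ω ≤ t} ≤ ENNReal.ofReal (max t 0) := by
      refine ge_of_tendsto hlim ?_
      filter_upwards [Ioo_mem_nhdsGT (max_lt ht one_pos)] with s hs
      refine (measure_mono fun ω (hω : U ω ≤ t) => ?_).trans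
        (hlt s ⟨(le_max_right _ _).trans_lt hs.1, hs.2⟩)
      exact hω.trans_lt ((le_max_left _ _).trans_lt hs.1)
    rcases le_total t 0 with h | h
    · simpa [h, ENNReal.ofReal_of_nonpos h] using this
    · simpa [h] using this
  have hdown : ∀ t : ℝ, 0 < t → ENNReal.ofReal (min t 1) ≤ P {ω | U ω ≤ t} := by
    intro t ht
    have hlim : Tendsto (fun s : ℝ => ENNReal.ofReal s) (𝓝[<] (min t 1))
        (𝓝 (ENNReal.ofReal (min t 1))) :=
      (ENNReal.continuous_ofReal.tendsto _).mono_left nhdsWithin_le_nhds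
    refine le_of_tendsto hlim ?_
    filter_upwards [Ioo_mem_nhdsLT (lt_min ht one_pos)] with s hs
    refine (hle s ⟨hs.1, hs.2.trans_le (min_le_right _ _)⟩).trans
      (measure_mono fun ω (hω : U ω ≤ s) => ?_)
    exact hω.trans (hs.2.le.trans (min_le_left _ _))
  refine Measure.ext_of_Iic _ _ fun t => ?_
  rw [Measure.map_apply hU measurableSet_Iic, Measure.restrict_apply measurableSet_Iic,
    Set.inter_comm, Set.Ioc_inter_Iic, Real.volume_Ioc, sub_zero, min_comm]
  change P {ω | U ω ≤ t} = _
  rcases le_or_gt t 0 with h | h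
  · rw [ENNReal.ofReal_of_nonpos ((min_le_left _ _).trans h)]
    exact le_antisymm ((hup t (by linarith)).trans_eq (ENNReal.ofReal_of_nonpos h)) zero_le
  · refine le_antisymm ?_ (hdown t h)
    rcases lt_or_ge t 1 with h1 | h1
    · rw [min_eq_left h1.le]; exact hup t h1
    · rw [min_eq_right h1]; simpa using prob_le_one

/-- The distribution function of an atomless law transforms it into the uniform one. -/
lemma map_cdf_eq_uniform (μ : Measure ℝ) [IsProbabilityMeasure μ] (hμ : ∀ x, μ {x} = 0) :
    μ.map (ProbabilityTheory.cdf μ) = volume.restrict (Set.Ioc 0 1) := by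
  set F := ProbabilityTheory.cdf μ
  have hmono : Monotone F := F.mono
  have hcont : Continuous F := by
    refine continuous_iff_continuousAt.2 fun x => ?_
    have h := F.measure_singleton x
    rw [ProbabilityTheory.measure_cdf, hμ] at h
    have h1 : F x ≤ Function.leftLim F x := by simpa using h
    rw [hmono.continuousAt_iff_leftLim_eq_rightLim, F.rightLim_eq]
    exact le_antisymm (hmono.leftLim_le le_rfl) h1
  -- By continuity each level `t` equals some `F y`; then `{F < t} ⊆ (-∞, y] ⊆ {F ≤ t}`, and the
  -- middle set has mass `t`.
  have hex : ∀ t ∈ Set.Ioo (0 : ℝ) 1, ∃ y, F y = t := fun t ht =>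
    mem_range_of_exists_le_of_exists_ge hcont
      ((ProbabilityTheory.tendsto_cdf_atBot μ).eventually_le_const ht.1).exists
      ((ProbabilityTheory.tendsto_cdf_atTop μ).eventually_const_le ht.2).exists
  refine map_eq_uniform hmono.measurable (fun t ht => ?_) (fun t ht => ?_)
  · obtain ⟨y, rfl⟩ := hex t ht
    rw [ProbabilityTheory.ofReal_cdf]
    exact measure_mono fun x (hx : F x < F y) => (hmono.reflect_lt hx).le
  · obtain ⟨y, rfl⟩ := hex t ht
    rw [ProbabilityTheory.ofReal_cdf]
    exact measure_mono fun x (hx : x ≤ y) => hmono hx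

/-- Conditionally on a non-null fibre, `w` still has a diffuse law, so its conditional distribution
function makes it uniform. The conditional probability is written as one formula in `(φ ω, w ω)` so
that a single measurable `V` serves all fibres. -/
lemma Atomless.exists_uniform_on_fibers {Ω : Type*} [MeasurableSpace Ω] {P : Measure Ω}
    [IsFiniteMeasure P] (hP : Atomless P) {φ : Ω → ℝ} (hφ : Measurable φ) :
    ∃ V : Ω → ℝ, Measurable V ∧ ∀ x,
      (P.restrict (φ ⁻¹' {x})).map V = P (φ ⁻¹' {x}) • volume.restrict (Set.Ioc 0 1) := by
  obtain ⟨w, hw, hw0⟩ := hP.exists_measurable_null_fibers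
  let G : ℝ × ℝ → ℝ≥0∞ := fun z => P {ω | φ ω = z.1 ∧ w ω ≤ z.2}
  have hG : Measurable G := by
    have hS : MeasurableSet {p : (ℝ × ℝ) × Ω | φ p.2 = p.1.1 ∧ w p.2 ≤ p.1.2} :=
      (measurableSet_eq_fun (hφ.comp measurable_snd) (measurable_fst.comp measurable_fst)).inter
        (measurableSet_le (hw.comp measurable_snd) (measurable_snd.comp measurable_fst))
    exact measurable_measure_prodMk_left hS
  have hD : Measurable fun x : ℝ => P {ω | φ ω = x} := by
    have hS : MeasurableSet {p : ℝ × Ω | φ p.2 = p.1} :=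
      measurableSet_eq_fun (hφ.comp measurable_snd) measurable_fst
    exact measurable_measure_prodMk_left hS
  have hV : Measurable fun ω => ((P {ω' | φ ω' = φ ω})⁻¹ * G (φ ω, w ω)).toReal :=
    ((hD.comp hφ).inv.mul (hG.comp (hφ.prodMk hw))).ennreal_toReal
  refine ⟨_, hV, fun x => ?_⟩
  have hA : MeasurableSet (φ ⁻¹' {x}) := hφ (measurableSet_singleton x)
  by_cases h0 : P (φ ⁻¹' {x}) = 0
  · rw [h0, Measure.restrict_eq_zero.2 h0, Measure.map_zero, zero_smul]
  have hQ := ProbabilityTheory.cond_isProbabilityMeasure (μ := P) h0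
  have hrestr : P.restrict (φ ⁻¹' {x}) = P (φ ⁻¹' {x}) • ProbabilityTheory.cond P (φ ⁻¹' {x}) := by
    rw [ProbabilityTheory.cond, smul_smul, ENNReal.mul_inv_cancel h0 (measure_ne_top _ _), one_smul]
  set Q := ProbabilityTheory.cond P (φ ⁻¹' {x})
  have hμ := Measure.isProbabilityMeasure_map (μ := Q) hw.aemeasurable
  have hae : (fun ω => ((P {ω' | φ ω' = φ ω})⁻¹ * G (φ ω, w ω)).toReal) =ᵐ[Q]
      fun ω => ProbabilityTheory.cdf (Q.map w) (w ω) := by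
    filter_upwards [ProbabilityTheory.ae_cond_mem hA] with ω hω
    have hω' : φ ω = x := hω
    rw [ProbabilityTheory.cdf_eq_real, measureReal_def, Measure.map_apply hw measurableSet_Iic,
      ProbabilityTheory.cond_apply hA, hω']
    rfl
  rw [hrestr, Measure.map_smul, Measure.map_congr hae]
  congr 1
  rw [← map_cdf_eq_uniform (Q.map w), Measure.map_map (ProbabilityTheory.monotone_cdf _).measurable hw]
  · rfl
  · intro y
    rw [Measure.map_apply hw (measurableSet_singleton y), ProbabilityTheory.cond_apply hA,
      measure_mono_null Set.inter_subset_right (hw0 y), mul_zero]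

/-! ### Rotations and the distributional transform -/

/-- Rotation of the unit interval, with values in `(0, 1]`. -/
noncomputable def rotate (c s : ℝ) : ℝ := toIocMod one_pos 0 (s + c)

lemma rotate_mem (c s : ℝ) : rotate c s ∈ Set.Ioc (0 : ℝ) 1 := by
  simpa [rotate] using toIocMod_mem_Ioc (one_pos : (0 : ℝ) < 1) 0 (s + c)

/-- This is translation invariance on the circle, read through its identification with `(0, 1]`. -/
lemma measurePreserving_rotate (c : ℝ) :
    MeasurePreserving (rotate c) (volume.restrict (Set.Ioc 0 1)) (volume.restrict (Set.Ioc 0 1)) := by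
  have h1 : MeasurePreserving ((↑) : ℝ → AddCircle (1 : ℝ)) (volume.restrict (Set.Ioc 0 1)) := by
    simpa using AddCircle.measurePreserving_mk (1 : ℝ) 0
  have h2 := measurePreserving_add_right (volume : Measure (AddCircle (1 : ℝ))) (c : AddCircle (1 : ℝ))
  have h3 := AddCircle.measurePreserving_equivIoc (1 : ℝ) (a := 0)
  have h4 : MeasurePreserving ((↑) : Set.Ioc (0 : ℝ) (0 + 1) → ℝ) (Measure.comap Subtype.val volume)
    (volume.restrict (Set.Ioc 0 (0 + 1))) := measurePreserving_subtype_coe measurableSet_Ioc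
  have := h4.comp (h3.comp (h2.comp h1))
  simpa using! this

/-- The uniform variable that interpolates between `P (φ < x)` and `P (φ ≤ x)` on `{φ = x}`. -/
noncomputable def distribTransform {Ω : Type*} [MeasurableSpace Ω] (P : Measure Ω) (φ V : Ω → ℝ)
    (ω : Ω) : ℝ :=
  (1 - V ω) * P.real {ω' | φ ω' < φ ω} + V ω * P.real {ω' | φ ω' ≤ φ ω}

lemma distribTransform_mem_Icc {Ω : Type*} [MeasurableSpace Ω] (P : Measure Ω)
    [IsFiniteMeasure P] {φ V : Ω → ℝ} {ω : Ω} (hV : V ω ∈ Set.Icc (0 : ℝ) 1) :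
    distribTransform P φ V ω ∈
      Set.Icc (P.real {ω' | φ ω' < φ ω}) (P.real {ω' | φ ω' ≤ φ ω}) := by
  have hab : P.real {ω' | φ ω' < φ ω} ≤ P.real {ω' | φ ω' ≤ φ ω} :=
    measureReal_mono fun ω' (h : φ ω' < φ ω) => h.le
  have h1 := mul_le_mul_of_nonneg_left hab (sub_nonneg.2 hV.2)
  have h2 := mul_le_mul_of_nonneg_left hab hV.1
  unfold distribTransform
  constructor <;> linarith

/-- The level `t` falls in the jump, possibly trivial, of the distribution function at `x = inf {y |
t ≤ F y}`. -/
lemma exists_quantile {Ω : Type*} [MeasurableSpace Ω] (P : Measure Ω) [IsProbabilityMeasure P]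
    {φ : Ω → ℝ} (hφ : Measurable φ) {t : ℝ} (ht : t ∈ Set.Ioo (0 : ℝ) 1) :
    ∃ x, P.real {ω | φ ω < x} ≤ t ∧ t ≤ P.real {ω | φ ω ≤ x} := by
  have := Measure.isProbabilityMeasure_map (μ := P) hφ.aemeasurable
  set μ := P.map φ
  set F := ProbabilityTheory.cdf μ
  have hF : ∀ y, F y = P.real {ω | φ ω ≤ y} := fun y => by
    rw [ProbabilityTheory.cdf_eq_real, measureReal_def, Measure.map_apply hφ measurableSet_Iic]; rfl
  let S := {y | t ≤ F y}
  have hne : S.Nonempty :=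
    ((ProbabilityTheory.tendsto_cdf_atTop μ).eventually_const_le ht.2).exists
  have hbdd : BddBelow S := by
    obtain ⟨z, hz⟩ := ((ProbabilityTheory.tendsto_cdf_atBot μ).eventually_lt_const ht.1).exists
    exact ⟨z, fun y (hy : t ≤ F y) => (F.mono.reflect_lt (hz.trans_le hy)).le⟩
  refine ⟨sInf S, ?_, ?_⟩
  · have h : P {ω | φ ω < sInf S} = ENNReal.ofReal (Function.leftLim F (sInf S) - 0) := by
      rw [← F.measure_Iio (ProbabilityTheory.tendsto_cdf_atBot μ), ProbabilityTheory.measure_cdf,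
        Measure.map_apply hφ measurableSet_Iio]; rfl
    rw [measureReal_def, h, sub_zero]
    refine ENNReal.toReal_le_of_le_ofReal ht.1.le (ENNReal.ofReal_le_ofReal ?_)
    refine le_of_tendsto (F.mono.tendsto_leftLim _) ?_
    filter_upwards [self_mem_nhdsWithin] with y hy
    by_contra! h
    exact (notMem_of_lt_csInf hy hbdd) h.le
  · rw [← hF, ← F.iInf_Ioi_eq]
    refine le_ciInf fun y => ?_
    obtain ⟨z, hz, hzy⟩ := exists_lt_of_csInf_lt hne y.2
    exact le_trans hz (F.mono hzy.le)

/-- For each `t`, an event of probability exactly `t` sits between `{U < t}` and `{U ≤ t}`: take `{φ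
< x}` with `x` a `t`-quantile, and add the fraction of `{φ = x}` still needed, cut out by `V ≤ s`.
-/
lemma distribTransform_uniform {Ω : Type*} [MeasurableSpace Ω] {P : Measure Ω}
    [IsProbabilityMeasure P] {φ V : Ω → ℝ} (hφ : Measurable φ) (hV : Measurable V)
    (hV01 : ∀ ω, V ω ∈ Set.Icc (0 : ℝ) 1)
    (hlaw : ∀ x, (P.restrict (φ ⁻¹' {x})).map V =
      P (φ ⁻¹' {x}) • volume.restrict (Set.Ioc 0 1)) :
    Measurable (distribTransform P φ V) ∧
      P.map (distribTransform P φ V) = volume.restrict (Set.Ioc 0 1) := by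
  have ha : Monotone fun x => P.real {ω | φ ω < x} := fun x y h =>
    measureReal_mono fun ω (hω : φ ω < x) => hω.trans_le h
  have hb : Monotone fun x => P.real {ω | φ ω ≤ x} := fun x y h =>
    measureReal_mono fun ω (hω : φ ω ≤ x) => hω.trans h
  have hba : ∀ {x y}, x < y → P.real {ω | φ ω ≤ x} ≤ P.real {ω | φ ω < y} := fun h =>
    measureReal_mono fun ω hω => lt_of_le_of_lt hω h
  have hU : Measurable (distribTransform P φ V) :=
    ((measurable_const.sub hV).mul (ha.measurable.comp hφ)).add (hV.mul (hb.measurable.comp hφ))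
  have key : ∀ t ∈ Set.Ioo (0 : ℝ) 1, ∃ E, P E = ENNReal.ofReal t ∧
      {ω | distribTransform P φ V ω < t} ⊆ E ∧ E ⊆ {ω | distribTransform P φ V ω ≤ t} := by
    intro t ht
    obtain ⟨x, hax, hbx⟩ := exists_quantile P hφ ht
    set a := P.real {ω | φ ω < x} with ha_def
    set b := P.real {ω | φ ω ≤ x} with hb_def
    have hA : MeasurableSet (φ ⁻¹' {x}) := hφ (measurableSet_singleton x)
    have hp : P.real (φ ⁻¹' {x}) = b - a := by
      have : {ω | φ ω ≤ x} = {ω | φ ω < x} ∪ φ ⁻¹' {x} := by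
        ext ω; simp [le_iff_lt_or_eq]
      rw [hb_def, this, measureReal_union _ hA]
      · ring
      · exact Set.disjoint_left.2 fun ω (h : φ ω < x) (h' : φ ω = x) => h.ne h'
    -- If `b = a`, division by zero gives `s = 0`, which still satisfies `(b - a) * s = t - a`
    -- because then `t = a`.
    set s := (t - a) / (b - a) with hs_def
    have hs0 : 0 ≤ s := div_nonneg (by linarith) (by linarith)
    have hs1 : s ≤ 1 := div_le_one_of_le₀ (by linarith) (by linarith)
    have hps : (b - a) * s = t - a := by
      rcases eq_or_ne (b - a) 0 with h | h
      · rw [h, zero_mul]; linarith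
      · exact mul_div_cancel₀ _ h
    have hmeas : P (φ ⁻¹' {x} ∩ {ω | V ω ≤ s}) = ENNReal.ofReal (t - a) := by
      have h := congrArg (fun m : Measure ℝ => m (Set.Iic s)) (hlaw x)
      simp only [Measure.smul_apply, smul_eq_mul] at h
      rw [Measure.map_apply hV measurableSet_Iic, Measure.restrict_apply (hV measurableSet_Iic),
        Measure.restrict_apply measurableSet_Iic, Set.inter_comm (Set.Iic s), Set.Ioc_inter_Iic,
        Real.volume_Ioc, sub_zero, min_eq_right hs1, ← ofReal_measureReal (s := φ ⁻¹' {x}), hp,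
        ← ENNReal.ofReal_mul (by linarith), hps, Set.inter_comm] at h
      exact h
    refine ⟨{ω | φ ω < x} ∪ (φ ⁻¹' {x} ∩ {ω | V ω ≤ s}), ?_, ?_, ?_⟩
    · rw [measure_union _ (hA.inter (measurableSet_le hV measurable_const)), hmeas, ← ofReal_measureReal,
        ← ENNReal.ofReal_add measureReal_nonneg (by linarith)]
      · congr 1; linarith
      · exact Set.disjoint_left.2 fun ω (h : φ ω < x) h' => h.ne h'.1
    · intro ω (hω : _ < t)
      rcases lt_trichotomy (φ ω) x with h | h | h
      · exact Or.inl h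
      · refine Or.inr ⟨h, ?_⟩
        have hval : distribTransform P φ V ω = a + (b - a) * V ω := by
          unfold distribTransform; rw [h]; ring
        rw [hval] at hω
        have h2 : (b - a) * V ω < (b - a) * s := by linarith
        exact (lt_of_mul_lt_mul_left h2 (by linarith)).le
      · have := (hba h).trans (distribTransform_mem_Icc P (hV01 ω)).1
        linarith
    · rintro ω (h | ⟨h, h'⟩)
      · exact ((distribTransform_mem_Icc P (hV01 ω)).2.trans (hba h)).trans hax
      · have h : φ ω = x := h
        have hval : distribTransform P φ V ω = a + (b - a) * V ω := by
          unfold distribTransform; rw [h]; ring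
        have : (b - a) * V ω ≤ (b - a) * s := mul_le_mul_of_nonneg_left h' (by linarith)
        change distribTransform P φ V ω ≤ t
        linarith
  refine ⟨hU, map_eq_uniform hU (fun t ht => ?_) (fun t ht => ?_)⟩
  · obtain ⟨E, hE, h1, -⟩ := key t ht
    exact hE ▸ measure_mono h1
  · obtain ⟨E, hE, -, h2⟩ := key t ht
    exact hE ▸ measure_mono h2

/-! ### Quantile rearrangement -/

/-- A bounded random variable has the law of a monotone function of any uniform variable. -/
lemma exists_monotone_rearrangement {Ω : Type*} [MeasurableSpace Ω] (P : Measure Ω)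
    [IsProbabilityMeasure P] {X : Ω → ℝ} (hX : Measurable X) {K : ℝ} (hK : 0 ≤ K)
    (hX0 : ∀ᵐ ω ∂P, 0 ≤ X ω ∧ X ω ≤ K) :
    ∃ q : ℝ → ℝ, Monotone q ∧ (∀ u, q u ∈ Set.Icc 0 K) ∧
      ∀ U : Ω → ℝ, Measurable U → P.map U = volume.restrict (Set.Ioc 0 1) →
        P.map (fun ω => q (U ω)) = P.map X := by
  have := Measure.isProbabilityMeasure_map (μ := P) hX.aemeasurable
  set F := ProbabilityTheory.cdf (P.map X)
  -- The clauses `0 ≤ x` and `K ≤ x` clamp the quantile to `[0, K]`, so that it is finite and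
  -- monotone at every real `u`.
  let S : ℝ → Set ℝ := fun u => {x | 0 ≤ x ∧ (u ≤ F x ∨ K ≤ x)}
  have hKS : ∀ u, K ∈ S u := fun u => ⟨hK, Or.inr le_rfl⟩
  have hbdd : ∀ u, BddBelow (S u) := fun u => ⟨0, fun x hx => hx.1⟩
  have hqmono : Monotone fun u => sInf (S u) := fun u u' h =>
    csInf_le_csInf (hbdd u) ⟨K, hKS u'⟩ fun x hx => ⟨hx.1, hx.2.imp_left h.trans⟩
  have hq01 : ∀ u, sInf (S u) ∈ Set.Icc 0 K := fun u =>
    ⟨le_csInf ⟨K, hKS u⟩ fun x hx => hx.1, csInf_le (hbdd u) (hKS u)⟩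
  have hiff : ∀ u x, 0 ≤ x → x < K → (sInf (S u) ≤ x ↔ u ≤ F x) := by
    refine fun u x hx0 hxK => ⟨fun h => ?_, fun h => csInf_le (hbdd u) ⟨hx0, Or.inl h⟩⟩
    rw [← F.iInf_Ioi_eq]
    refine le_ciInf fun y => ?_
    obtain ⟨z, hz, hzy⟩ := exists_lt_of_csInf_lt ⟨K, hKS u⟩ (h.trans_lt (lt_min y.2 hxK))
    rcases hz.2 with h' | h'
    · exact h'.trans (F.mono (hzy.le.trans (min_le_left _ _)))
    · exact absurd (hzy.trans_le (min_le_right _ _)) h'.not_gt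
  refine ⟨_, hqmono, hq01, fun U hU hlaw => ?_⟩
  have hqU : Measurable fun ω => sInf (S (U ω)) := hqmono.measurable.comp hU
  have := Measure.isProbabilityMeasure_map (μ := P) hqU.aemeasurable
  refine Measure.ext_of_Iic _ _ fun x => ?_
  rcases lt_or_ge x 0 with h0 | h0
  · rw [Measure.map_apply hqU measurableSet_Iic, Measure.map_apply hX measurableSet_Iic]
    have h1 : (fun ω => sInf (S (U ω))) ⁻¹' Set.Iic x = ∅ :=
      Set.eq_empty_of_forall_notMem fun ω (hω : _ ≤ x) => by linarith [(hq01 (U ω)).1]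
    have h2 : P (X ⁻¹' Set.Iic x) = 0 :=
      measure_eq_zero_iff_ae_notMem.2 (hX0.mono fun ω h (hω : X ω ≤ x) => by linarith [h.1])
    rw [h1, h2, measure_empty]
  rcases lt_or_ge x K with h1 | h1
  · have hset : (fun ω => sInf (S (U ω))) ⁻¹' Set.Iic x = U ⁻¹' Set.Iic (F x) := by
      ext ω; exact hiff _ _ h0 h1
    rw [Measure.map_apply hqU measurableSet_Iic, hset, ← Measure.map_apply hU measurableSet_Iic,
      hlaw, Measure.restrict_apply measurableSet_Iic, Set.inter_comm, Set.Ioc_inter_Iic,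
      Real.volume_Ioc, sub_zero, min_eq_right (ProbabilityTheory.cdf_le_one _ x),
      ProbabilityTheory.ofReal_cdf]
  · rw [Measure.map_apply hqU measurableSet_Iic, Measure.map_apply hX measurableSet_Iic]
    have h2 : (fun ω => sInf (S (U ω))) ⁻¹' Set.Iic x = Set.univ :=
      Set.eq_univ_of_forall fun ω => (hq01 (U ω)).2.trans h1
    have h3 : P (X ⁻¹' Set.Iic x) = 1 := by
      rw [← mem_ae_iff_prob_eq_one (hX measurableSet_Iic)]
      filter_upwards [hX0] with ω hω using hω.2.trans h1
    rw [h2, h3, measure_univ]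

/-! ### Joint tails -/

/-- The probability that two variables jointly exceed a pair of positive levels. -/
noncomputable def jointTail {Ω : Type*} [MeasurableSpace Ω] (P : Measure Ω) (φ X : Ω → ℝ)
    (z : ℝ × ℝ) : ℝ≥0∞ :=
  P {ω | (0 < z.1 ∧ z.1 < φ ω) ∧ (0 < z.2 ∧ z.2 < X ω)}

lemma measurableSet_jointTail {Ω : Type*} [MeasurableSpace Ω] {φ X : Ω → ℝ} (hφ : Measurable φ)
    (hX : Measurable X) : MeasurableSet
      {p : Ω × (ℝ × ℝ) | (0 < p.2.1 ∧ p.2.1 < φ p.1) ∧ (0 < p.2.2 ∧ p.2.2 < X p.1)} := by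
  measurability

lemma measurable_jointTail {Ω : Type*} [MeasurableSpace Ω] (P : Measure Ω) [SFinite P]
    {φ X : Ω → ℝ} (hφ : Measurable φ) (hX : Measurable X) : Measurable (jointTail P φ X) :=
  measurable_measure_prodMk_right (measurableSet_jointTail hφ hX)

/-- Layer cake formula for the expectation of a product. -/
lemma lintegral_mul_eq_lintegral_jointTail {Ω : Type*} [MeasurableSpace Ω] (P : Measure Ω)
    [SFinite P] {φ X : Ω → ℝ} (hφ : Measurable φ) (hX : Measurable X) :
    ∫⁻ ω, ENNReal.ofReal (φ ω) * ENNReal.ofReal (X ω) ∂P = ∫⁻ z, jointTail P φ X z := by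
  have hS := measurableSet_jointTail hφ hX
  calc ∫⁻ ω, ENNReal.ofReal (φ ω) * ENNReal.ofReal (X ω) ∂P
      = (P.prod volume) _ := by
        rw [Measure.prod_apply hS]
        refine lintegral_congr fun ω => ?_
        rw [show Prod.mk ω ⁻¹' {p : Ω × (ℝ × ℝ) |
            (0 < p.2.1 ∧ p.2.1 < φ p.1) ∧ (0 < p.2.2 ∧ p.2.2 < X p.1)} =
            Set.Ioo 0 (φ ω) ×ˢ Set.Ioo 0 (X ω) from rfl, Measure.volume_eq_prod,
          Measure.prod_prod, Real.volume_Ioo, Real.volume_Ioo, sub_zero, sub_zero]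
    _ = ∫⁻ z, jointTail P φ X z := by rw [Measure.prod_apply_symm hS]; rfl

/-- The probability of an intersection is at most the smaller of the two probabilities; nested
events attain this bound, and `X'` has the tails of `X`. -/
lemma jointTail_le_of_comonotone {Ω : Type*} [MeasurableSpace Ω] {P : Measure Ω}
    {φ X X' : Ω → ℝ} (hX : Measurable X) (hX' : Measurable X')
    (hlaw : P.map X' = P.map X)
    (hco : ∀ y t, {ω | y < φ ω} ⊆ {ω | t < X' ω} ∨ {ω | t < X' ω} ⊆ {ω | y < φ ω})
    (z : ℝ × ℝ) : jointTail P φ X z ≤ jointTail P φ X' z := by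
  by_cases h1 : 0 < z.1
  swap; · simp [jointTail, h1]
  by_cases h2 : 0 < z.2
  swap; · simp [jointTail, h2]
  have htail : P {ω | z.2 < X ω} = P {ω | z.2 < X' ω} := by
    have := congrArg (fun m : Measure ℝ => m (Set.Ioi z.2)) hlaw
    simp only [Measure.map_apply hX measurableSet_Ioi, Measure.map_apply hX' measurableSet_Ioi]
      at this
    exact this.symm
  rcases hco z.1 z.2 with h | h
  · refine measure_mono fun ω hω => ?_
    exact ⟨hω.1, h2, h hω.1.2⟩
  · calc jointTail P φ X z ≤ P {ω | z.2 < X ω} := measure_mono fun ω hω => hω.2.2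
      _ = P {ω | z.2 < X' ω} := htail
      _ ≤ jointTail P φ X' z := by
        refine measure_mono fun ω hω => ?_
        exact ⟨⟨h1, h hω⟩, h2, hω⟩

/-- Equality in the Hardy-Littlewood inequality forces comonotonicity. -/
lemma null_or_null_of_jointTail_ae_eq {Ω : Type*} [MeasurableSpace Ω] {P : Measure Ω}
    [IsFiniteMeasure P] {φ X X' : Ω → ℝ} (hφ : Measurable φ) (hX : Measurable X)
    (hX' : Measurable X') (hlaw : P.map X' = P.map X)
    (hco : ∀ y t, {ω | y < φ ω} ⊆ {ω | t < X' ω} ∨ {ω | t < X' ω} ⊆ {ω | y < φ ω})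
    (heq : jointTail P φ X =ᵐ[volume] jointTail P φ X')
    {c c' s s' : ℝ} (hc : 0 ≤ c) (hcc : c < c') (hs : 0 ≤ s) (hss : s < s') :
    P {ω | φ ω < c ∧ s' < X ω} = 0 ∨ P {ω | c' < φ ω ∧ X ω < s} = 0 := by
  -- The tails agree only almost everywhere, but a conull set is dense, so it meets the open
  -- rectangle left by the gaps `c < c'` and `s < s'`.
  obtain ⟨z, hz, hzr⟩ := (Measure.dense_of_ae heq).exists_mem_open
    (isOpen_Ioo.prod isOpen_Ioo : IsOpen (Set.Ioo c c' ×ˢ Set.Ioo s s'))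
    ((Set.nonempty_Ioo.2 hcc).prod (Set.nonempty_Ioo.2 hss))
  have hz : jointTail P φ X z = jointTail P φ X' z := hz
  obtain ⟨⟨hz1, hz1'⟩, hz2, hz2'⟩ := hzr
  have hp1 := hc.trans_lt hz1
  have hp2 := hs.trans_lt hz2
  have hJ : ∀ Y : Ω → ℝ, jointTail P φ Y z = P ({ω | z.1 < φ ω} ∩ {ω | z.2 < Y ω}) := fun Y => by
    unfold jointTail; congr 1; ext ω; simp [hp1, hp2]
  have htail : P {ω | z.2 < X ω} = P {ω | z.2 < X' ω} := by
    have := congrArg (fun m : Measure ℝ => m (Set.Ioi z.2)) hlaw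
    simp only [Measure.map_apply hX measurableSet_Ioi, Measure.map_apply hX' measurableSet_Ioi]
      at this
    exact this.symm
  have hmφ : MeasurableSet {ω | z.1 < φ ω} := measurableSet_lt measurable_const hφ
  have hmX : MeasurableSet {ω | z.2 < X ω} := measurableSet_lt measurable_const hX
  rw [hJ, hJ] at hz
  rcases hco z.1 z.2 with h | h
  · right
    rw [Set.inter_eq_left.2 h] at hz
    have h0 : P ({ω | z.1 < φ ω} \ {ω | z.2 < X ω}) = 0 := by
      have := measure_inter_add_sdiff (μ := P) {ω | z.1 < φ ω} hmX
      rw [hz] at this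
      exact (ENNReal.add_right_inj (measure_ne_top _ _)).1 (this.trans (add_zero _).symm)
    refine measure_mono_null (fun ω hω => ?_) h0
    exact ⟨hz1'.trans hω.1, fun h => lt_asymm h (hω.2.trans hz2)⟩
  · left
    rw [Set.inter_eq_right.2 h, ← htail, Set.inter_comm] at hz
    have h0 : P ({ω | z.2 < X ω} \ {ω | z.1 < φ ω}) = 0 := by
      have := measure_inter_add_sdiff (μ := P) {ω | z.2 < X ω} hmφ
      rw [hz] at this
      exact (ENNReal.add_right_inj (measure_ne_top _ _)).1 (this.trans (add_zero _).symm)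
    refine measure_mono_null (fun ω hω => ?_) h0
    exact ⟨hz2'.trans hω.2, fun h => lt_asymm h (hω.1.trans hz1)⟩

/-! ### Riemann sums along rotation orbits -/

/-- Averages of a monotone function over a rotation orbit approximate its integral uniformly. -/
lemma abs_average_rotate_sub_integral_le {q : ℝ → ℝ} (hq : Monotone q) {K : ℝ}
    (hqK : ∀ u, q u ∈ Set.Icc 0 K) (s : ℝ) {n : ℕ} (hn : n ≠ 0) :
    |(n : ℝ)⁻¹ * ∑ k ∈ Finset.range n, q (rotate (k / n) s) - ∫ u in (0 : ℝ)..1, q u| ≤ K / n := by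
  have hn0 : (0 : ℝ) < n := by positivity
  let g : ℝ → ℝ := fun x => q (toIocMod one_pos 0 x)
  have hg : ∀ x, g (x + 1) = g x := fun x => by simp [g]
  -- `S` has period `1 / n`, so the starting point can be moved into `(0, 1 / n]`, where no term
  -- wraps around.
  let S : ℝ → ℝ := fun x => ∑ k ∈ Finset.range n, g (x + k / n)
  have hS : Function.Periodic S (n : ℝ)⁻¹ := fun x => by
    have h1 : ∀ k : ℕ, g (x + (n : ℝ)⁻¹ + k / n) = g (x + ((k + 1 : ℕ) : ℝ) / n) := fun k => by
      congr 1; push_cast; ring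
    have h2 := Finset.sum_range_succ (fun k : ℕ => g (x + k / n)) n
    rw [Finset.sum_range_succ', div_self hn0.ne', hg] at h2
    simp only [S, h1]
    simpa using h2
  obtain ⟨y, hy, hSy⟩ := hS.exists_mem_Ioc (inv_pos.2 hn0) s 0
  rw [zero_add] at hy
  have hsum : ∑ k ∈ Finset.range n, q (rotate (k / n) s) =
      ∑ k ∈ Finset.range n, q (y + k / n) := by
    refine (show _ = S s from rfl).trans (hSy.trans (Finset.sum_congr rfl fun k hk => ?_))
    have hk : (k : ℝ) + 1 ≤ n := by exact_mod_cast Finset.mem_range.1 hk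
    have hle : y + k / n ≤ 1 := by
      calc y + k / n ≤ (n : ℝ)⁻¹ + k / n := by gcongr; exact hy.2
        _ = (k + 1) / n := by ring
        _ ≤ 1 := div_le_one_of_le₀ hk hn0.le
    have : toIocMod (one_pos : (0 : ℝ) < 1) 0 (y + k / n) = y + k / n :=
      (toIocMod_eq_self _).2 ⟨by have := hy.1; positivity, by simpa using hle⟩
    simp [g, this]
  have hmono : MonotoneOn (fun x : ℝ => q (x / n)) (Set.Icc 0 (0 + n)) :=
    fun x _ x' _ h => hq (by gcongr)
  have hint : ∫ u in (0 : ℝ)..(0 + n), q (u / n) = n * ∫ u in (0 : ℝ)..1, q u := by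
    rw [intervalIntegral.integral_comp_div _ hn0.ne']
    simp [div_self hn0.ne']
  -- The sum `A` and `n` times the integral both lie between the left and right endpoint sums, which
  -- differ by `q 1 - q 0 ≤ K`.
  have hlo := hmono.sum_le_integral
  have hhi := hmono.integral_le_sum
  rw [hint] at hlo hhi
  simp only [zero_add] at hlo hhi
  have h3 := Finset.sum_range_succ (fun k : ℕ => q ((k : ℝ) / n)) n
  rw [Finset.sum_range_succ', div_self hn0.ne'] at h3
  have h4 : ∑ k ∈ Finset.range n, q ((k : ℝ) / n) ≤ ∑ k ∈ Finset.range n, q (y + k / n) :=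
    Finset.sum_le_sum fun k _ => hq (by linarith [hy.1])
  have h5 : ∑ k ∈ Finset.range n, q (y + k / n) ≤
      ∑ k ∈ Finset.range n, q (((k + 1 : ℕ) : ℝ) / n) :=
    Finset.sum_le_sum fun k _ => hq (by
      push_cast
      calc y + k / n ≤ (n : ℝ)⁻¹ + k / n := by gcongr; exact hy.2
        _ = (k + 1) / n := by ring)
  have h6 := (hqK 1).2
  have h7 := (hqK ((0 : ℕ) / n)).1
  rw [hsum]
  set A := ∑ k ∈ Finset.range n, q (y + k / n)
  set I := ∫ u in (0 : ℝ)..1, q u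
  have h8 : (n : ℝ)⁻¹ * A - I = (A - n * I) / n := by field_simp
  rw [h8, abs_div, abs_of_pos hn0]
  gcongr
  rw [abs_le]
  constructor <;> linarith

/-! ### The Hardy-Littlewood inequality and comonotonicity -/

lemma integrable_mul_of_bounded {Ω : Type*} [MeasurableSpace Ω] {P : Measure Ω}
    {φ X : Ω → ℝ} (hφ : Integrable φ P) (hX : Measurable X) {K : ℝ}
    (hXK : ∀ᵐ ω ∂P, 0 ≤ X ω ∧ X ω ≤ K) : Integrable (fun ω => φ ω * X ω) P :=
  hφ.mul_bdd (c := K) hX.aestronglyMeasurable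
    (hXK.mono fun ω h => by rw [Real.norm_of_nonneg h.1]; exact h.2)

/-- The Hardy-Littlewood inequality, with its equality case. -/
lemma hardy_littlewood {Ω : Type*} [MeasurableSpace Ω] {P : Measure Ω} [IsFiniteMeasure P]
    {φ X X' : Ω → ℝ} (hφ : Measurable φ) (hφ0 : ∀ᵐ ω ∂P, 0 ≤ φ ω) (hφi : Integrable φ P)
    (hX : Measurable X) (hX' : Measurable X') {K : ℝ}
    (hXK : ∀ᵐ ω ∂P, 0 ≤ X ω ∧ X ω ≤ K) (hXK' : ∀ᵐ ω ∂P, 0 ≤ X' ω ∧ X' ω ≤ K)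
    (hlaw : P.map X' = P.map X)
    (hco : ∀ y t, {ω | y < φ ω} ⊆ {ω | t < X' ω} ∨ {ω | t < X' ω} ⊆ {ω | y < φ ω}) :
    ∫ ω, φ ω * X ω ∂P ≤ ∫ ω, φ ω * X' ω ∂P ∧
    (∫ ω, φ ω * X ω ∂P = ∫ ω, φ ω * X' ω ∂P →
      ∀ c c' s s' : ℝ, 0 ≤ c → c < c' → 0 ≤ s → s < s' →
        P {ω | φ ω < c ∧ s' < X ω} = 0 ∨ P {ω | c' < φ ω ∧ X ω < s} = 0) := by
  have hconv : ∀ Y : Ω → ℝ, Measurable Y → (∀ᵐ ω ∂P, 0 ≤ Y ω ∧ Y ω ≤ K) →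
      ENNReal.ofReal (∫ ω, φ ω * Y ω ∂P) = ∫⁻ z, jointTail P φ Y z := by
    intro Y hY hYK
    rw [← lintegral_mul_eq_lintegral_jointTail P hφ hY,
      ofReal_integral_eq_lintegral_ofReal (integrable_mul_of_bounded hφi hY hYK)]
    · exact lintegral_congr_ae (hφ0.mono fun ω h => ENNReal.ofReal_mul h)
    · filter_upwards [hφ0, hYK] with ω h1 h2 using mul_nonneg h1 h2.1
  have hle := jointTail_le_of_comonotone hX hX' hlaw hco
  have hnonneg : 0 ≤ ∫ ω, φ ω * X' ω ∂P := integral_nonneg_of_ae (by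
    filter_upwards [hφ0, hXK'] with ω h1 h2 using mul_nonneg h1 h2.1)
  refine ⟨?_, fun heq c c' s s' hc hcc hs hss => ?_⟩
  · rw [← ENNReal.ofReal_le_ofReal_iff hnonneg, hconv X hX hXK, hconv X' hX' hXK']
    exact lintegral_mono hle
  · refine null_or_null_of_jointTail_ae_eq hφ hX hX' hlaw hco ?_ hc hcc hs hss
    refine ae_eq_of_ae_le_of_lintegral_le (.of_forall hle) ?_
      (measurable_jointTail P hφ hX').aemeasurable ?_
    · rw [← hconv X hX hXK]; exact ENNReal.ofReal_ne_top
    · rw [← hconv X hX hXK, ← hconv X' hX' hXK', heq]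

/-- The number `P (φ ≤ y)` separates the values of the transform on `{φ ≤ y}` from those on `{y <
φ}`; the inclusion depends on whether `q` exceeds `t` there. -/
lemma comonotone_distribTransform {Ω : Type*} [MeasurableSpace Ω] {P : Measure Ω}
    [IsFiniteMeasure P] {φ V : Ω → ℝ} (hV : ∀ ω, V ω ∈ Set.Icc (0 : ℝ) 1)
    {q : ℝ → ℝ} (hq : Monotone q) (y t : ℝ) :
    {ω | y < φ ω} ⊆ {ω | t < q (distribTransform P φ V ω)} ∨
      {ω | t < q (distribTransform P φ V ω)} ⊆ {ω | y < φ ω} := by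
  rcases lt_or_ge t (q (P.real {ω | φ ω ≤ y})) with h | h
  · refine Or.inl fun ω (hω : y < φ ω) => h.trans_le (hq ?_)
    refine le_trans ?_ (distribTransform_mem_Icc P (hV ω)).1
    exact measureReal_mono fun ω' (h' : φ ω' ≤ y) => h'.trans_lt hω
  · refine Or.inr fun ω (hω : t < _) => ?_
    by_contra hy
    have hy : φ ω ≤ y := not_lt.1 hy
    refine hω.not_ge ((hq ?_).trans h)
    refine (distribTransform_mem_Icc P (hV ω)).2.trans ?_
    exact measureReal_mono fun ω' (h' : φ ω' ≤ φ ω) => h'.trans hy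

/-! ### Risk functionals: laws, convexity, approximation -/

/-- Law invariance for the risk of payoffs. -/
lemma IsAdmissible.neg_eq_of_map_eq {Ω : Type*} [MeasurableSpace Ω] {P : Measure Ω}
    [IsProbabilityMeasure P] {K : ℝ} {ρ : Lp ℝ ∞ P → ℝ} (hρ : IsAdmissible P K ρ)
    {X Y : Lp ℝ ∞ P} (h : P.map X = P.map Y) : ρ (-X) = ρ (-Y) := by
  have hneg : ∀ Z : Lp ℝ ∞ P, P.map (-Z : Lp ℝ ∞ P) = (P.map Z).map Neg.neg := fun Z => by
    rw [Measure.map_map measurable_neg (Lp.stronglyMeasurable Z).measurable]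
    exact Measure.map_congr (Lp.coeFn_neg Z)
  exact hρ.lawInvariant _ _ (by rw [hneg, hneg, h])

lemma IsAdmissible.convexOn {Ω : Type*} [MeasurableSpace Ω] {P : Measure Ω}
    [IsProbabilityMeasure P] {K : ℝ} {ρ : Lp ℝ ∞ P → ℝ} (hρ : IsAdmissible P K ρ) :
    ConvexOn ℝ Set.univ ρ := by
  refine ⟨convex_univ, fun X _ Y _ a b ha hb hab => ?_⟩
  obtain rfl : b = 1 - a := by linarith
  simpa using hρ.convex X Y a ha (by linarith)

/-- If `Y` is approximated uniformly from above, up to errors tending to zero, by classes of risk at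
most `r`, then `Y` has risk at most `r`. -/
lemma IsAdmissible.neg_le_of_approx {Ω : Type*} [MeasurableSpace Ω] {P : Measure Ω}
    [IsProbabilityMeasure P] {K : ℝ} {ρ : Lp ℝ ∞ P → ℝ} (hρ : IsAdmissible P K ρ)
    {Y : Lp ℝ ∞ P} {A : ℕ → Lp ℝ ∞ P} {ε : ℕ → ℝ} (hε : Antitone ε) (hε0 : Tendsto ε atTop (𝓝 0))
    (hle : ∀ n, ∀ᵐ ω ∂P, Y ω ≤ A n ω + ε n) {r : ℝ} (hr : ∀ n, ρ (-A n) ≤ r) : ρ (-Y) ≤ r := by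
  have hcoe : ∀ n, ∀ᵐ ω ∂P, (Lp.const ∞ P (ε n)) ω = ε n := fun n => Lp.coeFn_const _ _ _
  have hW : Antitone fun n => -(Y - Lp.const ∞ P (ε n)) := by
    intro m n h
    rw [neg_le_neg_iff, ← Lp.coeFn_le]
    filter_upwards [Lp.coeFn_sub Y (Lp.const ∞ P (ε m)), Lp.coeFn_sub Y (Lp.const ∞ P (ε n)),
      hcoe m, hcoe n] with ω h1 h2 h3 h4
    rw [h1, h2, Pi.sub_apply, Pi.sub_apply, h3, h4]
    linarith [hε h]
  refine le_of_tendsto' (hρ.continuousFromAbove _ (-Y) hW ?_) fun n => le_trans ?_ (hr n)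
  · have h1 : ∀ᵐ ω ∂P, ∀ n, (-(Y - Lp.const ∞ P (ε n))) ω = ε n - Y ω :=
      ae_all_iff.2 fun n => by
        filter_upwards [Lp.coeFn_neg (Y - Lp.const ∞ P (ε n)), Lp.coeFn_sub Y (Lp.const ∞ P (ε n)),
          hcoe n] with ω h1 h2 h3
        rw [h1, Pi.neg_apply, h2, Pi.sub_apply, h3, neg_sub]
    filter_upwards [h1, Lp.coeFn_neg Y] with ω h2 h3
    simp only [h2, h3, Pi.neg_apply]
    simpa using hε0.sub_const (Y ω)
  · refine hρ.monotone _ _ ?_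
    rw [← Lp.coeFn_le]
    filter_upwards [Lp.coeFn_sub Y (Lp.const ∞ P (ε n)), hcoe n, hle n] with ω h1 h2 h3
    rw [h1, Pi.sub_apply, h2]
    linarith

/-! ### Improvement by a monotone function of `φ` -/

/-- Every bounded class is dominated by a monotone function of `φ`: it has no larger risk and no
smaller `φ`-weighted expectation, with equality only in the comonotone case. -/
lemma exists_monotone_improvement {Ω : Type*} [MeasurableSpace Ω] {P : Measure Ω}
    [IsProbabilityMeasure P] (hP : Atomless P) {φ : Ω → ℝ} (hφ : Measurable φ)
    (hφ0 : ∀ᵐ ω ∂P, 0 ≤ φ ω) (hφi : Integrable φ P) {K : ℝ} {ρ : Lp ℝ ∞ P → ℝ}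
    (hρ : IsAdmissible P K ρ) (X : Lp ℝ ∞ P) (hXK : ∀ᵐ ω ∂P, 0 ≤ X ω ∧ X ω ≤ K) :
    ∃ f : ℝ → ℝ, Monotone f ∧ (∀ x, f x ∈ Set.Icc 0 K) ∧
      ∃ Y : Lp ℝ ∞ P, (Y =ᵐ[P] fun ω => f (φ ω)) ∧ ρ (-Y) ≤ ρ (-X) ∧
        ∫ ω, φ ω * X ω ∂P ≤ ∫ ω, φ ω * Y ω ∂P ∧
        (∫ ω, φ ω * X ω ∂P = ∫ ω, φ ω * Y ω ∂P →
          ∀ c c' s s' : ℝ, 0 ≤ c → c < c' → 0 ≤ s → s < s' →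
            P {ω | φ ω < c ∧ s' < X ω} = 0 ∨ P {ω | c' < φ ω ∧ X ω < s} = 0) := by
  have hK : 0 ≤ K := by
    obtain ⟨ω, h⟩ := hXK.exists
    exact h.1.trans h.2
  have hXm : Measurable X := (Lp.stronglyMeasurable X).measurable
  obtain ⟨V, hV, hVlaw⟩ := hP.exists_uniform_on_fibers hφ
  obtain ⟨q, hq, hqK, hqlaw⟩ := exists_monotone_rearrangement P hXm hK hXK
  have hmemLp : ∀ g : Ω → ℝ, Measurable g → (∀ ω, g ω ∈ Set.Icc 0 K) → MemLp g ∞ P :=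
    fun g hg h => memLp_top_of_bound hg.aestronglyMeasurable K
      (.of_forall fun ω => by rw [Real.norm_of_nonneg (h ω).1]; exact (h ω).2)
  -- the rearrangement of `X` along a rotated uniform variable
  let R : ℝ → Ω → ℝ := fun c ω => q (distribTransform P φ (fun ω => rotate c (V ω)) ω)
  have hrot01 : ∀ c ω, rotate c (V ω) ∈ Set.Icc (0 : ℝ) 1 := fun c ω =>
    Set.Ioc_subset_Icc_self (rotate_mem c (V ω))
  have hunif : ∀ c, Measurable (distribTransform P φ fun ω => rotate c (V ω)) ∧
      P.map (distribTransform P φ fun ω => rotate c (V ω)) = volume.restrict (Set.Ioc 0 1) := by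
    intro c
    have hr := measurePreserving_rotate c
    refine distribTransform_uniform hφ (hr.measurable.comp hV) (hrot01 c) fun x => ?_
    have := Measure.map_map (μ := P.restrict (φ ⁻¹' {x})) hr.measurable hV
    rw [hVlaw x, Measure.map_smul, hr.map_eq] at this
    exact this.symm
  have hRm : ∀ c, Measurable (R c) := fun c => hq.measurable.comp (hunif c).1
  have hRlaw : ∀ c, P.map (R c) = P.map X := fun c => hqlaw _ (hunif c).1 (hunif c).2
  have hRK : ∀ c ω, R c ω ∈ Set.Icc 0 K := fun c ω => hqK _
  have hRK' : ∀ c, ∀ᵐ ω ∂P, 0 ≤ R c ω ∧ R c ω ≤ K := fun c => .of_forall (hRK c)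
  have hRco : ∀ c y t, {ω | y < φ ω} ⊆ {ω | t < R c ω} ∨ {ω | t < R c ω} ⊆ {ω | y < φ ω} :=
    fun c => comonotone_distribTransform (hrot01 c) hq
  -- All rotated rearrangements share one law and are comonotone with `φ`, so Hardy-Littlewood
  -- applies in both directions.
  have hRint : ∀ c, ∫ ω, φ ω * R c ω ∂P = ∫ ω, φ ω * R 0 ω ∂P := fun c =>
    le_antisymm
      (hardy_littlewood hφ hφ0 hφi (hRm c) (hRm 0) (hRK' c) (hRK' 0)
        ((hRlaw 0).trans (hRlaw c).symm) (hRco 0)).1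
      (hardy_littlewood hφ hφ0 hφi (hRm 0) (hRm c) (hRK' 0) (hRK' c)
        ((hRlaw c).trans (hRlaw 0).symm) (hRco c)).1
  obtain ⟨hHL, hHLeq⟩ :=
    hardy_littlewood hφ hφ0 hφi hXm (hRm 0) hXK (hRK' 0) (hRlaw 0) (hRco 0)
  -- averaging over the fibres of `φ`
  let h : ℝ → ℝ → ℝ := fun x s =>
    q ((1 - s) * P.real {ω | φ ω < x} + s * P.real {ω | φ ω ≤ x})
  have hh : ∀ x, Monotone (h x) := fun x s s' hs => hq (by
    have : P.real {ω | φ ω < x} ≤ P.real {ω | φ ω ≤ x} :=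
      measureReal_mono fun ω (hω : φ ω < x) => hω.le
    nlinarith)
  have hhint : ∀ x, IntervalIntegrable (h x) volume 0 1 := fun x => (hh x).intervalIntegrable
  -- `f (φ)` is a version of the conditional expectation of `R 0` given `φ`, obtained below as a
  -- uniform limit of averages.
  let f : ℝ → ℝ := fun x => ∫ s in (0 : ℝ)..1, h x s
  have hf : Monotone f := by
    intro x y hxy
    refine intervalIntegral.integral_mono_on zero_le_one (hhint x) (hhint y) fun s hs => hq ?_
    have h1 : P.real {ω | φ ω < x} ≤ P.real {ω | φ ω < y} :=
      measureReal_mono fun ω (hω : φ ω < x) => hω.trans_le hxy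
    have h2 : P.real {ω | φ ω ≤ x} ≤ P.real {ω | φ ω ≤ y} :=
      measureReal_mono fun ω (hω : φ ω ≤ x) => hω.trans hxy
    exact add_le_add (mul_le_mul_of_nonneg_left h1 (sub_nonneg.2 hs.2))
      (mul_le_mul_of_nonneg_left h2 hs.1)
  have hfK : ∀ x, f x ∈ Set.Icc 0 K := by
    intro x
    constructor
    · exact intervalIntegral.integral_nonneg zero_le_one fun s _ => (hqK _).1
    · have := intervalIntegral.integral_mono_on zero_le_one (hhint x)
        (intervalIntegrable_const (c := K)) fun s _ => (hqK _).2
      simpa using this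
  have hfm : Measurable fun ω => f (φ ω) := hf.measurable.comp hφ
  -- At fixed `ω`, rotation moves only `V ω`, so `R (k / n) ω` is `h (φ ω)` along a rotation orbit.
  have happrox : ∀ n : ℕ, n ≠ 0 → ∀ ω,
      |(n : ℝ)⁻¹ * ∑ k ∈ Finset.range n, R (k / n) ω - f (φ ω)| ≤ K / n := fun n hn ω =>
    abs_average_rotate_sub_integral_le (hh (φ ω)) (fun u => hqK _) (V ω) hn
  let Y : Lp ℝ ∞ P := (hmemLp _ hfm fun ω => hfK _).toLp _
  have hY : Y =ᵐ[P] fun ω => f (φ ω) := MemLp.coeFn_toLp _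
  -- The shift to `n + 1` avoids `K / 0 = 0`, which could break antitonicity.
  have hεanti : Antitone fun n : ℕ => K / ((n + 1 : ℕ) : ℝ) := fun m n h => by
    dsimp only; gcongr
  have hεlim : Tendsto (fun n : ℕ => K / ((n + 1 : ℕ) : ℝ)) atTop (𝓝 0) :=
    (tendsto_const_div_atTop_nhds_zero_nat K).comp (tendsto_add_atTop_nat 1)
  have hmY : ∫ ω, φ ω * R 0 ω ∂P ≤ ∫ ω, φ ω * f (φ ω) ∂P := by
    have hfi : Integrable (fun ω => φ ω * f (φ ω)) P :=
      integrable_mul_of_bounded hφi hfm (.of_forall fun ω => hfK _)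
    have hlim : Tendsto (fun n : ℕ => ∫ ω, φ ω * f (φ ω) ∂P +
        K / ((n + 1 : ℕ) : ℝ) * ∫ ω, φ ω ∂P) atTop (𝓝 (∫ ω, φ ω * f (φ ω) ∂P)) := by
      simpa using (hεlim.mul_const (∫ ω, φ ω ∂P)).const_add (∫ ω, φ ω * f (φ ω) ∂P)
    refine ge_of_tendsto' hlim fun n => ?_
    have hn0 : ((n + 1 : ℕ) : ℝ) ≠ 0 := by positivity
    have hRi : ∀ c, Integrable (fun ω => φ ω * R c ω) P := fun c =>
      integrable_mul_of_bounded hφi (hRm c) (hRK' c)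
    have h1 : ∫ ω, φ ω * R 0 ω ∂P = ∫ ω, ((n + 1 : ℕ) : ℝ)⁻¹ *
        ∑ k ∈ Finset.range (n + 1), φ ω * R (k / (n + 1 : ℕ)) ω ∂P := by
      rw [integral_const_mul, integral_finsetSum _ fun k _ => hRi _]
      simp only [hRint, Finset.sum_const, Finset.card_range, nsmul_eq_mul]
      rw [inv_mul_cancel_left₀ hn0]
    rw [h1, ← integral_const_mul, ← integral_add hfi (hφi.const_mul _)]
    refine integral_mono_ae ((integrable_finsetSum _ fun k _ => hRi _).const_mul _)
      (hfi.add (hφi.const_mul _)) ?_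
    filter_upwards [hφ0] with ω hω
    have h2 := (abs_le.1 (happrox (n + 1) n.succ_ne_zero ω)).2
    have h3 := mul_le_mul_of_nonneg_left h2 hω
    rw [← Finset.mul_sum]
    linarith
  have hYint : ∫ ω, φ ω * Y ω ∂P = ∫ ω, φ ω * f (φ ω) ∂P :=
    integral_congr_ae (hY.mono fun ω h => by simp only [h])
  refine ⟨f, hf, hfK, Y, hY, ?_, ?_, fun heq => hHLeq ?_⟩
  · let Z : ℝ → Lp ℝ ∞ P := fun c => (hmemLp _ (hRm c) (hRK c)).toLp _
    have hZ : ∀ c, Z c =ᵐ[P] R c := fun c => MemLp.coeFn_toLp _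
    have hZρ : ∀ c, ρ (-Z c) = ρ (-X) := fun c =>
      hρ.neg_eq_of_map_eq ((Measure.map_congr (hZ c)).trans (hRlaw c))
    let A : ℕ → Lp ℝ ∞ P := fun n =>
      ∑ k ∈ Finset.range (n + 1), ((n + 1 : ℕ) : ℝ)⁻¹ • Z (k / (n + 1 : ℕ))
    have hA : ∀ n, ∀ᵐ ω ∂P, A n ω = ((n + 1 : ℕ) : ℝ)⁻¹ *
        ∑ k ∈ Finset.range (n + 1), R (k / (n + 1 : ℕ)) ω := by
      intro n
      have h1 : ∀ᵐ ω ∂P, ∀ k : ℕ, (((n + 1 : ℕ) : ℝ)⁻¹ • Z (k / (n + 1 : ℕ))) ω =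
          ((n + 1 : ℕ) : ℝ)⁻¹ * R (k / (n + 1 : ℕ)) ω := ae_all_iff.2 fun k => by
        filter_upwards [Lp.coeFn_smul ((n + 1 : ℕ) : ℝ)⁻¹ (Z (k / (n + 1 : ℕ))), hZ (k / (n + 1 : ℕ))]
          with ω h1 h2
        rw [h1, Pi.smul_apply, h2, smul_eq_mul]
      filter_upwards [h1, Lp.coeFn_fun_finsetSum (Finset.range (n + 1))
        fun k : ℕ => ((n + 1 : ℕ) : ℝ)⁻¹ • Z (k / (n + 1 : ℕ))] with ω h1 h2
      rw [h2, Finset.mul_sum]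
      exact Finset.sum_congr rfl fun k _ => h1 k
    refine hρ.neg_le_of_approx (A := A) hεanti hεlim (fun n => ?_) (fun n => ?_)
    · filter_upwards [hA n, hY] with ω h1 h2
      rw [h1, h2]
      linarith [(abs_le.1 (happrox (n + 1) n.succ_ne_zero ω)).1]
    · have h1 := hρ.convexOn.map_sum_le (t := Finset.range (n + 1))
        (w := fun _ => ((n + 1 : ℕ) : ℝ)⁻¹) (p := fun k : ℕ => -Z (k / (n + 1 : ℕ)))
        (fun _ _ => by positivity)
        (by
          rw [Finset.sum_const, Finset.card_range, nsmul_eq_mul]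
          exact mul_inv_cancel₀ (by positivity))
        (fun _ _ => Set.mem_univ _)
      simp only [hZρ, smul_eq_mul, Finset.sum_const, Finset.card_range, nsmul_eq_mul, smul_neg,
        Finset.sum_neg_distrib] at h1
      rwa [mul_inv_cancel_left₀ (by positivity)] at h1
  · rw [hYint]; exact hHL.trans hmY
  · exact le_antisymm hHL ((hmY.trans_eq hYint.symm).trans_eq heq.symm)

/-! ### Binding constraint -/

/-- The moment constraint is binding at every solution. -/
lemma IsSolution.integral_eq {Ω : Type*} [MeasurableSpace Ω] {P : Measure Ω}
    [IsProbabilityMeasure P] (hP : Atomless P) {φ : Ω → ℝ}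
    {K v : ℝ} (hv : 0 ≤ v) {ρ : Lp ℝ ∞ P → ℝ} (hρ : IsAdmissible P K ρ) {X : Lp ℝ ∞ P}
    (hX : IsSolution P φ K v ρ X) : ∫ ω, φ ω * X ω ∂P = v := by
  obtain ⟨⟨hXK, hXv⟩, hmin⟩ := hX
  refine le_antisymm (not_lt.1 fun hlt => ?_) hXv
  have hXm : Measurable X := (Lp.stronglyMeasurable X).measurable
  have hX0 : 0 ≤ᵐ[P] X := hXK.mono fun ω h => h.1
  have hpos : 0 < ∫ ω, φ ω * X ω ∂P := hv.trans_lt hlt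
  -- `X` has larger risk than the zero payoff
  have hstrict : ρ (-(Lp.const ∞ P (0 : ℝ))) < ρ (-X) := by
    -- With weight `1` the improvement is a constant, at least `E[X] > 0` and no riskier than `X`,
    -- so strict monotonicity along constants applies.
    obtain ⟨f, -, hfK, Y, hY, hYρ, hYint, -⟩ := exists_monotone_improvement hP
      (φ := fun _ => 1) measurable_const (.of_forall fun _ => zero_le_one)
      (integrable_const 1) hρ X hXK
    have hYc : Y = Lp.const ∞ P (f 1) := Lp.ext (hY.trans (Lp.coeFn_const _ _ _).symm)
    have hEX : 0 < ∫ ω, X ω ∂P := by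
      refine lt_of_le_of_ne (integral_nonneg_of_ae hX0) fun h0 => hpos.ne' ?_
      have hXi : Integrable X P := by
        simpa using integrable_mul_of_bounded (integrable_const (1 : ℝ)) hXm hXK
      have := (integral_eq_zero_iff_of_nonneg_ae hX0 hXi).1 h0.symm
      rw [integral_congr_ae (g := fun _ => (0 : ℝ)) (this.mono fun ω h => by simp [h])]
      simp
    have hm : 0 < f 1 := by
      have : ∫ ω, (1 : ℝ) * Y ω ∂P = f 1 := by
        rw [integral_congr_ae (g := fun _ => f 1) (hY.mono fun ω h => by simp [h])]
        simp
      rw [this] at hYint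
      simpa using hEX.trans_le (by simpa using hYint)
    rw [hYc] at hYρ
    exact (hρ.strictMonoOn_const ⟨le_rfl, hm.le.trans (hfK 1).2⟩ (hfK 1) hm).trans_le hYρ
  -- This factor brings the moment of `l • X` down to exactly `v`; by convexity with the less risky
  -- zero payoff, `l • X` would beat `X`.
  set l := v / ∫ ω, φ ω * X ω ∂P with hl
  have hl0 : 0 ≤ l := div_nonneg hv hpos.le
  have hl1 : l < 1 := (div_lt_one hpos).2 hlt
  have hlX : ∀ᵐ ω ∂P, (l • X) ω = l * X ω := by
    filter_upwards [Lp.coeFn_smul l X] with ω h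
    simp [h]
  have hfeas : IsFeasible P φ K v (l • X) := by
    refine ⟨?_, ?_⟩
    · filter_upwards [hlX, hXK] with ω h1 h2
      rw [h1]
      exact ⟨mul_nonneg hl0 h2.1, (mul_le_of_le_one_left h2.1 hl1.le).trans h2.2⟩
    · have : ∫ ω, φ ω * (l • X) ω ∂P = l * ∫ ω, φ ω * X ω ∂P := by
        rw [← integral_const_mul]
        exact integral_congr_ae (hlX.mono fun ω h => by simp only [h]; ring)
      rw [this, hl, div_mul_cancel₀ _ hpos.ne']
  have h1 := hmin _ hfeas
  have h2 := hρ.convex (-X) (-(Lp.const ∞ P (0 : ℝ))) l hl0 hl1.le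
  have h3 : l • (-X) + (1 - l) • (-(Lp.const ∞ P (0 : ℝ))) = -(l • X) := by simp
  rw [h3] at h2
  nlinarith

/-! ### From comonotonicity to a monotone function -/

/-- A bounded variable that is a function of `φ` and comonotone with it is an increasing function
of `φ`. -/
lemma exists_monotone_of_null_or_null {Ω : Type*} [MeasurableSpace Ω] {P : Measure Ω}
    {φ X : Ω → ℝ} (hφ0 : ∀ᵐ ω ∂P, 0 ≤ φ ω) {K : ℝ} (hK : 0 ≤ K)
    (hXK : ∀ᵐ ω ∂P, 0 ≤ X ω ∧ X ω ≤ K) {Z : Ω → ℝ} (hXZ : X =ᵐ[P] Z)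
    (hZ : Function.FactorsThrough Z φ)
    (hco : ∀ c c' s s' : ℝ, 0 ≤ c → c < c' → 0 ≤ s → s < s' →
      P {ω | φ ω < c ∧ s' < X ω} = 0 ∨ P {ω | c' < φ ω ∧ X ω < s} = 0) :
    ∃ f : ℝ → ℝ, Monotone f ∧ (∀ x, f x ∈ Set.Icc 0 K) ∧ X =ᵐ[P] fun ω => f (φ ω) := by
  -- Rational levels leave countably many null events to discard, yet separate any two points that
  -- violate monotonicity.
  have hnull : ∀ᵐ ω ∂P, ∀ a b : ℚ,
      (P {ω | φ ω < a ∧ b < X ω} = 0 → ¬(φ ω < a ∧ b < X ω)) ∧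
      (P {ω | a < φ ω ∧ X ω < b} = 0 → ¬(a < φ ω ∧ X ω < b)) := by
    refine ae_all_iff.2 fun a => ae_all_iff.2 fun b => Filter.Eventually.and ?_ ?_
    · by_cases h : P {ω | φ ω < a ∧ b < X ω} = 0
      · exact (measure_eq_zero_iff_ae_notMem.1 h).mono fun ω hω _ => hω
      · exact .of_forall fun ω h' => absurd h' h
    · by_cases h : P {ω | a < φ ω ∧ X ω < b} = 0
      · exact (measure_eq_zero_iff_ae_notMem.1 h).mono fun ω hω _ => hω
      · exact .of_forall fun ω h' => absurd h' h
  obtain ⟨G, hG, hGp⟩ := (hnull.and (hφ0.and (hXK.and hXZ))).exists_mem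
  have hmono : ∀ ω ∈ G, ∀ ω' ∈ G, φ ω ≤ φ ω' → X ω ≤ X ω' := by
    intro ω hω ω' hω' h
    obtain ⟨hn, hφω, -, hXω⟩ := hGp ω hω
    obtain ⟨hn', -, hX', hXω'⟩ := hGp ω' hω'
    rcases h.eq_or_lt with h | h
    · rw [hXω, hXω', hZ h]
    by_contra! hlt
    obtain ⟨c, hc, hc'⟩ := exists_rat_btwn h
    obtain ⟨c', hcc, hcφ⟩ := exists_rat_btwn hc'
    obtain ⟨s, hs, hs'⟩ := exists_rat_btwn hlt
    obtain ⟨s', hss, hsX⟩ := exists_rat_btwn hs'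
    rcases hco c c' s s' (hφω.trans hc.le) hcc (hX'.1.trans hs.le) hss with h0 | h0
    · exact (hn c s').1 h0 ⟨hc, hsX⟩
    · exact (hn' c' s).2 h0 ⟨hcφ, hs⟩
  -- The running supremum extends the monotone relation from the good set to the whole line; the
  -- inserted `0` keeps it nonempty and nonnegative.
  let T : ℝ → Set ℝ := fun x => insert 0 {y | ∃ ω ∈ G, φ ω ≤ x ∧ X ω = y}
  have hTK : ∀ x, ∀ y ∈ T x, y ≤ K := by
    rintro x y (rfl | ⟨ω, hω, -, rfl⟩)
    · exact hK
    · exact (hGp ω hω).2.2.1.2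
  have hTbdd : ∀ x, BddAbove (T x) := fun x => ⟨K, hTK x⟩
  have hTne : ∀ x, (T x).Nonempty := fun x => Set.insert_nonempty _ _
  refine ⟨fun x => sSup (T x), fun x x' h => ?_, fun x => ⟨?_, ?_⟩, ?_⟩
  · refine csSup_le_csSup (hTbdd x') (hTne x) (Set.insert_subset_insert ?_)
    rintro y ⟨ω, hω, hx, rfl⟩
    exact ⟨ω, hω, hx.trans h, rfl⟩
  · exact le_csSup (hTbdd x) (Set.mem_insert _ _)
  · exact csSup_le (hTne x) (hTK x)
  · filter_upwards [hG] with ω hω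
    refine le_antisymm (le_csSup (hTbdd _) (Set.mem_insert_of_mem _ ⟨ω, hω, le_rfl, rfl⟩))
      (csSup_le (hTne _) ?_)
    rintro y (rfl | ⟨ω', hω', h, rfl⟩)
    · exact (hGp ω hω).2.2.1.1
    · exact hmono ω' hω' ω hω h

end NeymanPearson

/-! ### The main theorem -/

theorem proposition2p5 {Ω : Type*} [MeasurableSpace Ω] (P : MeasureTheory.Measure Ω)
    [MeasureTheory.IsProbabilityMeasure P] (hP : NeymanPearson.Atomless P)
    (φ : Ω → ℝ) (hφ_meas : Measurable φ) (hφ_pos : ∀ᵐ ω ∂P, 0 < φ ω)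
    (hφ_one : ∫ ω, φ ω ∂P = 1)
    (K v : ℝ) (hv : 0 ≤ v) (hvK : v ≤ K)
    (ρ : Lp ℝ ∞ P → ℝ) (hρ : NeymanPearson.IsAdmissible P K ρ) :
    -- every `σ(φ)`-measurable solution is an increasing function of `φ`
    (∀ X : Lp ℝ ∞ P, NeymanPearson.IsSolution P φ K v ρ X →
      NeymanPearson.IsSigmaMeasurable P φ X →
      ∃ f : ℝ → ℝ, Monotone f ∧ (∀ x, f x ∈ Set.Icc 0 K) ∧ X =ᵐ[P] fun ω => f (φ ω)) ∧
    -- any solution gives rise to a solution that is an increasing function of `φ`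
    (∀ X : Lp ℝ ∞ P, NeymanPearson.IsSolution P φ K v ρ X →
      ∃ f : ℝ → ℝ, Monotone f ∧ (∀ x, f x ∈ Set.Icc 0 K) ∧
        ∃ Y : Lp ℝ ∞ P, (Y =ᵐ[P] fun ω => f (φ ω)) ∧
          NeymanPearson.IsSolution P φ K v ρ Y) := by
  have hφ0 : ∀ᵐ ω ∂P, 0 ≤ φ ω := hφ_pos.mono fun ω h => h.le
  -- A non-integrable `φ` would have integral `0` by convention, not `1`.
  have hφi : Integrable φ P := by
    by_contra h
    rw [integral_undef h] at hφ_one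
    exact zero_ne_one hφ_one
  have main : ∀ X : Lp ℝ ∞ P, NeymanPearson.IsSolution P φ K v ρ X →
      ∃ f : ℝ → ℝ, Monotone f ∧ (∀ x, f x ∈ Set.Icc 0 K) ∧
        ∃ Y : Lp ℝ ∞ P, (Y =ᵐ[P] fun ω => f (φ ω)) ∧ NeymanPearson.IsSolution P φ K v ρ Y ∧
        (∫ ω, φ ω * X ω ∂P = ∫ ω, φ ω * Y ω ∂P →
          ∀ c c' s s' : ℝ, 0 ≤ c → c < c' → 0 ≤ s → s < s' →
            P {ω | φ ω < c ∧ s' < X ω} = 0 ∨ P {ω | c' < φ ω ∧ X ω < s} = 0) := by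
    intro X hX
    obtain ⟨f, hf, hfK, Y, hY, hYρ, hYint, hco⟩ :=
      NeymanPearson.exists_monotone_improvement hP hφ_meas hφ0 hφi hρ X hX.1.1
    refine ⟨f, hf, hfK, Y, hY, ⟨⟨?_, hX.1.2.trans hYint⟩, fun W hW => hYρ.trans (hX.2 W hW)⟩, hco⟩
    filter_upwards [hY] with ω h
    rw [h]
    exact hfK _
  refine ⟨fun X hX hσ => ?_, fun X hX => ?_⟩
  · obtain ⟨f, hf, hfK, Y, hY, hYsol, hco⟩ := main X hX
    obtain ⟨Z, hZ, hXZ⟩ := hσ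
    refine NeymanPearson.exists_monotone_of_null_or_null hφ0 (hv.trans hvK) hX.1.1 hXZ
      hZ.factorsThrough (hco ?_)
    -- Both payoffs are solutions, so both moments equal `v`: this is the equality case.
    rw [hX.integral_eq hP hv hρ, hYsol.integral_eq hP hv hρ]
  · obtain ⟨f, hf, hfK, Y, hY, hYsol, -⟩ := main X hX
    exact ⟨f, hf, hfK, Y, hY, hYsol⟩
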